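/- Let $M\ge 2$ be even and $L=M/2$. For $m\in\{0,1,\dots,M\}$ let $\hat Y_m$ be a random variable taking values in $[0,1]$ with $\operatorname{Var}[\hat Y_m]\le\varepsilon^2$. Let $\hat p(m)=\frac1N\sum_{i=1}^N\hat Y^{(i)}_m$ be the mean estimator of $N$ copies $\hat Y^{(i)}_m$ of $\hat Y_m$ (that is, $\hat Y^{(i)}_m$ has the same distribution as $\hat Y_m$), where all the variables $\hat Y^{(i)}_m$, $1\le i\le N$, $0\le m\le M$, are mutually independent. Let $\operatorname{Hankel}_L(\hat p)=(\hat p(i+j))_{0\le i\le L,\;0\le j\le M-L}$ be the (square) Hankel matrix of the vector $\hat p=(\hat p(0),\dots,\hat p(M))$, let $\mathbb E$ act on matrices entrywise, and let $\|\cdot\|$ denote the spectral norm (the largest singular value). Let $\epsilon>0$ and $\delta>0$. If $$N\;\ge\;4\max\left\{\frac{M\varepsilon^2}{\epsilon^2},\ \frac{2}{3\epsilon}\right\}\log\frac{M}{\delta},$$ then $$\bigl\|\operatorname{Hankel}_L(\hat p)-\mathbb E\operatorname{Hankel}_L(\hat p)\bigr\|\le\epsilon$$ with probability at least $1-\delta$.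 -/

import Mathlib

open MeasureTheory ProbabilityTheory

open scoped Matrix.Norms.L2Operator

/-- The Hankel matrix `Hankel_L(y)` of the data `y = (y_0, …, y_M)`: the
`(L + 1) × (M - L + 1)` matrix whose entry at `(i, j)` (counted from `0`) is `y_{i+j}`,
so that its first row is `y_0, …, y_{M-L}` and its last row is `y_L, …, y_M`. -/
def hankel {M : ℕ} (L : ℕ) (hL : L ≤ M) (y : Fin (M + 1) → ℝ) :
    Matrix (Fin (L + 1)) (Fin (M - L + 1)) ℝ :=
  Matrix.of fun i j => y ⟨(i : ℕ) + (j : ℕ), by omega⟩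

/-- The mean estimator `p̂(m) = (1 / N) ∑ i, Y^{(i)}_m`, as a random vector. -/
noncomputable def meanEstimator {Ω ι : Type*} {N : ℕ} (Y : Fin N → ι → Ω → ℝ) (ω : Ω) :
    ι → ℝ :=
  fun m => (1 / (N : ℝ)) * ∑ i, Y i m ω

/-- The (entrywise) expectation of a random real matrix. -/
noncomputable def matrixExpectation {Ω m n : Type*} [MeasurableSpace Ω] (P : Measure Ω)
    (A : Ω → Matrix m n ℝ) : Matrix m n ℝ :=
  Matrix.of fun i j => ∫ ω, A ω i j ∂P

/-! Let `y` be the centred data vector, `v = ε ^ 2`, and ŷ its discrete Fourier transform of length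
`M + 1`. Since `i + j ≤ M`, there is no wrap-around: the bilinear form of the Hankel matrix is a
Fourier sum, and Parseval bounds its spectral norm by max |ŷ(k)|. As `y` is real, the frequencies `k
≤ L` suffice, so exp‖H‖ ≤ 2 Σ_{k ≤ L} cosh|ŷ(k)| (`IsPrimitiveRoot.exp_l2_opNorm_hankel_le`). Each
ŷ(k) is a sum of independent real variables times unit vectors of the plane ℂ. Because cosh √t is
convex and increasing in t, E cosh‖·‖ of such a sum is at most a product of scalar moment generating
bounds (`integral_cosh_norm_sum_le`). Bernstein's scalar bound and Markov's inequality then give a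
tail with prefactor `2 * L + 2 = M + 2` and variance factor `(M + 1) * v`. The claim has `M` in both
places. The constant 4 in the sample size leaves room: the exponent can be made (1 + 1/q) log(M/δ),
and the extra share 1/q absorbs the prefactor once M/δ is large enough. This always holds for `L ≥
3`. For `L = 1, 2` and small M/δ, Chebyshev's inequality for the Frobenius norm takes over. For `L =
1` and large M/δ, the Fourier bound is too lossy and an explicit 2 × 2 computation replaces it. -/

/-! ### Scalar inequalities for exp and cosh. -/

theorem two_sub_mul_exp_le {x : ℝ} (hx : 0 ≤ x) : (2 - x) * Real.exp x ≤ 2 + x := by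
  have hd : ∀ y : ℝ, HasDerivAt (fun y => 2 + y - (2 - y) * Real.exp y)
      (1 - (-1 * Real.exp y + (2 - y) * Real.exp y)) y := fun y =>
    ((hasDerivAt_id y).const_add 2).sub
      (((hasDerivAt_id y).const_sub 2).mul (Real.hasDerivAt_exp y))
  have hm : Monotone fun y : ℝ => 2 + y - (2 - y) * Real.exp y := by
    refine monotone_of_deriv_nonneg (fun y => (hd y).differentiableAt) fun y => ?_
    rw [(hd y).deriv]
    have h := mul_le_mul_of_nonneg_right (Real.add_one_le_exp (-y)) (Real.exp_pos y).le
    rw [← Real.exp_add, neg_add_cancel, Real.exp_zero] at h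
    linarith
  have h := hm hx
  simp only [Real.exp_zero] at h
  linarith

/-- The difference of the two sides vanishes at 0, and its derivative is one third of the difference
in `two_sub_mul_exp_le`. -/
theorem one_sub_div_three_mul_exp_le {x : ℝ} (hx : 0 ≤ x) :
    (1 - x / 3) * (Real.exp x - 1 - x) ≤ x ^ 2 / 2 := by
  have hd : ∀ y : ℝ, HasDerivAt (fun y => y ^ 2 / 2 - (1 - y / 3) * (Real.exp y - 1 - y))
      ((2 + y - (2 - y) * Real.exp y) / 3) y := fun y => by
    have := (((hasDerivAt_id y).pow 2).div_const 2).sub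
      ((((hasDerivAt_id y).div_const 3).const_sub 1).mul
        (((Real.hasDerivAt_exp y).sub_const 1).sub (hasDerivAt_id y)))
    refine HasDerivAt.congr_deriv this ?_
    simp only [id, Pi.sub_apply, Nat.cast_ofNat]
    ring
  have hm : MonotoneOn (fun y : ℝ => y ^ 2 / 2 - (1 - y / 3) * (Real.exp y - 1 - y))
      (Set.Ici 0) := by
    refine monotoneOn_of_deriv_nonneg (convex_Ici 0)
      (fun y _ => (hd y).continuousAt.continuousWithinAt)
      (fun y _ => (hd y).differentiableAt.differentiableWithinAt) fun y hy => ?_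
    rw [interior_Ici] at hy
    rw [(hd y).deriv]
    have := two_sub_mul_exp_le (le_of_lt hy)
    linarith
  have h := hm (Set.mem_Ici.2 le_rfl) (Set.mem_Ici.2 hx) hx
  simp only [Real.exp_zero] at h
  linarith

theorem exp_le_one_add_add_sq_of_nonpos {x : ℝ} (hx : x ≤ 0) :
    Real.exp x ≤ 1 + x + x ^ 2 / 2 := by
  have hd : ∀ y : ℝ, HasDerivAt (fun y => 1 + y + y ^ 2 / 2 - Real.exp y)
      (1 + y - Real.exp y) y := fun y => by
    have := (((hasDerivAt_id y).const_add 1).add (((hasDerivAt_id y).pow 2).div_const 2)).sub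
      (Real.hasDerivAt_exp y)
    refine HasDerivAt.congr_deriv this ?_
    simp only [id, Nat.cast_ofNat]
    ring
  have hm : Antitone fun y : ℝ => 1 + y + y ^ 2 / 2 - Real.exp y := by
    refine antitone_of_deriv_nonpos (fun y => (hd y).differentiableAt) fun y => ?_
    rw [(hd y).deriv]
    linarith [Real.add_one_le_exp y]
  have h := hm hx
  simp only [Real.exp_zero] at h
  linarith

/-- The pointwise inequality behind Bernstein's bound on moment generating functions. -/
theorem exp_le_one_add_add_sq_mul {x b : ℝ} (hxb : |x| ≤ b) (hb : b < 3) :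
    Real.exp x ≤ 1 + x + x ^ 2 * (1 / (2 * (1 - b / 3))) := by
  have hb3 : 0 < 1 - b / 3 := by linarith
  rcases le_total x 0 with hx | hx
  · refine (exp_le_one_add_add_sq_of_nonpos hx).trans ?_
    have hb0 : 0 ≤ b := (abs_nonneg x).trans hxb
    have : (1 : ℝ) / 2 ≤ 1 / (2 * (1 - b / 3)) :=
      one_div_le_one_div_of_le (by positivity) (by linarith)
    nlinarith [sq_nonneg x]
  · rw [abs_of_nonneg hx] at hxb
    have h := one_sub_div_three_mul_exp_le hx
    have h0 : 0 ≤ Real.exp x - 1 - x := by linarith [Real.add_one_le_exp x]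
    have h2 : (1 - b / 3) * (Real.exp x - 1 - x) ≤ x ^ 2 / 2 :=
      (mul_le_mul_of_nonneg_right (by linarith) h0).trans h
    have : Real.exp x - 1 - x ≤ x ^ 2 * (1 / (2 * (1 - b / 3))) := by
      rw [mul_one_div, le_div_iff₀ (by positivity)]
      linarith
    linarith

/-- cosh x is a power series in x² with nonnegative coefficients, hence a convex increasing function
of x²; the comparison is made term by term. -/
theorem cosh_le_of_sq_le {α β x y z : ℝ} (hα : 0 ≤ α) (hβ : 0 ≤ β) (hαβ : α + β = 1)
    (h : x ^ 2 ≤ α * y ^ 2 + β * z ^ 2) :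
    Real.cosh x ≤ α * Real.cosh y + β * Real.cosh z := by
  refine hasSum_le (fun n => ?_) (Real.hasSum_cosh x)
    (((Real.hasSum_cosh y).mul_left α).add ((Real.hasSum_cosh z).mul_left β))
  have hc := (convexOn_pow (𝕜 := ℝ) n).2 (Set.mem_Ici.2 (sq_nonneg y)) (Set.mem_Ici.2 (sq_nonneg z))
    hα hβ hαβ
  simp only [smul_eq_mul] at hc
  rw [pow_mul, pow_mul, pow_mul, ← mul_div_assoc, ← mul_div_assoc, ← add_div]
  gcongr
  exact (pow_le_pow_left₀ (sq_nonneg x) h n).trans hc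

/-! ### cosh of a norm in an inner product space. -/

section InnerProduct
variable {E : Type*} [NormedAddCommGroup E] [InnerProductSpace ℝ E]

theorem abs_inner_div_norm_le_one (p w : E) (hw : ‖w‖ = 1) : |inner ℝ p w / ‖p‖| ≤ 1 := by
  have h := abs_real_inner_le_norm p w
  rw [hw, mul_one] at h
  rw [abs_div, abs_norm]
  exact div_le_one_of_le₀ h (norm_nonneg p)

/-- A Golden–Thompson type inequality for the function `cosh ‖·‖`. -/
theorem cosh_norm_add_smul_le (p w : E) (hw : ‖w‖ = 1) (z : ℝ) :
    Real.cosh ‖p + z • w‖ ≤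
      Real.cosh ‖p‖ * Real.cosh z + inner ℝ p w / ‖p‖ * Real.sinh ‖p‖ * Real.sinh z := by
  set c := inner ℝ p w / ‖p‖ with hc
  obtain ⟨h1, h2⟩ := abs_le.1 (abs_inner_div_norm_le_one p w hw)
  -- At `p = 0` the quotient `c` is 0 by convention, and the identity still holds.
  have hpc : ‖p‖ * c = inner ℝ p w := by
    rcases eq_or_ne p 0 with rfl | hp
    · simp
    · rw [hc, mul_div_cancel₀ _ (norm_ne_zero_iff.2 hp)]
  -- With c the cosine of the angle, ‖p + z w‖² is exactly the average of (‖p‖ + z)² and (‖p‖ - z)²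
  -- with weights (1 ± c)/2.
  have h := cosh_le_of_sq_le (α := (1 + c) / 2) (β := (1 - c) / 2) (x := ‖p + z • w‖)
    (y := ‖p‖ + z) (z := ‖p‖ - z) (by linarith) (by linarith) (by ring) (by
      rw [norm_add_sq_real, inner_smul_right, norm_smul, hw, ← hpc, mul_one, Real.norm_eq_abs,
        sq_abs]
      apply le_of_eq
      ring)
  rw [Real.cosh_add, Real.cosh_sub] at h
  linarith

end InnerProduct

theorem cosh_sqrt_add_sq_le (u v : ℝ) :
    Real.cosh (Real.sqrt (u ^ 2 + v ^ 2)) ≤ Real.cosh u * Real.cosh v := by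
  have h := cosh_le_of_sq_le (α := 1 / 2) (β := 1 / 2) (x := Real.sqrt (u ^ 2 + v ^ 2))
    (y := u + v) (z := u - v) (by norm_num) (by norm_num) (by norm_num)
    (by rw [Real.sq_sqrt (by positivity)]; linarith)
  rw [Real.cosh_add, Real.cosh_sub] at h
  linarith

/-! ### Exponential moments of sums of independent vectors. -/

section Probability
variable {Ω : Type*} [MeasurableSpace Ω] {P : Measure Ω} [IsProbabilityMeasure P]

/-- Bernstein's bound on the moment generating function of a bounded centered variable. -/
theorem integral_exp_mul_le {X : Ω → ℝ} (hX : Measurable X) (hb : ∀ ω, |X ω| ≤ 1)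
    (h0 : ∫ ω, X ω ∂P = 0) {v : ℝ} (hv : ∫ ω, X ω ^ 2 ∂P ≤ v) {t μ : ℝ} (ht : |t| ≤ μ)
    (hμ : μ < 3) :
    ∫ ω, Real.exp (t * X ω) ∂P ≤ Real.exp (v * (μ ^ 2 / (2 * (1 - μ / 3)))) := by
  have hμ0 : 0 ≤ μ := (abs_nonneg t).trans ht
  have hX1 : Integrable X P := Integrable.of_bound hX.aestronglyMeasurable 1 (ae_of_all _ hb)
  have hX2 : Integrable (fun ω => X ω ^ 2) P :=
    Integrable.of_bound (hX.pow_const 2).aestronglyMeasurable 1 (ae_of_all _ fun ω => by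
      rw [Real.norm_eq_abs, abs_pow]
      exact pow_le_one₀ (abs_nonneg _) (hb ω))
  have htX : ∀ ω, |t * X ω| ≤ μ := fun ω => by
    rw [abs_mul]
    exact (mul_le_mul ht (hb ω) (abs_nonneg _) hμ0).trans (mul_one μ).le
  have hexp : Integrable (fun ω => Real.exp (t * X ω)) P :=
    Integrable.of_bound (hX.const_mul t).exp.aestronglyMeasurable (Real.exp μ)
      (ae_of_all _ fun ω => by
        rw [Real.norm_eq_abs, Real.abs_exp]
        exact Real.exp_le_exp.2 (le_of_abs_le (htX ω)))
  set c := 1 / (2 * (1 - μ / 3)) with hc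
  have hc0 : 0 ≤ c := by
    have : 0 < 1 - μ / 3 := by linarith
    positivity
  have hv0 : 0 ≤ v := (integral_nonneg fun ω => sq_nonneg (X ω)).trans hv
  have ht2 : t ^ 2 ≤ μ ^ 2 := sq_le_sq' (neg_le_of_abs_le ht) (le_of_abs_le ht)
  calc ∫ ω, Real.exp (t * X ω) ∂P
      ≤ ∫ ω, (1 + t * X ω + t ^ 2 * c * X ω ^ 2) ∂P := by
        refine integral_mono hexp
          (((integrable_const 1).add (hX1.const_mul t)).add (hX2.const_mul _)) fun ω => ?_
        have := exp_le_one_add_add_sq_mul (htX ω) hμ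
        simp only
        rw [mul_pow] at this
        linarith
    _ = 1 + t ^ 2 * c * ∫ ω, X ω ^ 2 ∂P := by
        have h1 : Integrable (fun ω => 1 + t * X ω) P :=
          (integrable_const 1).add (hX1.const_mul t)
        rw [integral_add h1 (hX2.const_mul _),
          integral_add (integrable_const 1) (hX1.const_mul t), integral_const_mul,
          integral_const_mul, h0]
        simp
    _ ≤ 1 + v * (μ ^ 2 / (2 * (1 - μ / 3))) := by
        rw [div_eq_mul_one_div (μ ^ 2), ← hc]
        have : t ^ 2 * c * ∫ ω, X ω ^ 2 ∂P ≤ μ ^ 2 * c * v :=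
          mul_le_mul (mul_le_mul_of_nonneg_right ht2 hc0) hv
            (integral_nonneg fun ω => sq_nonneg (X ω)) (by positivity)
        linarith
    _ ≤ _ := by rw [add_comm]; exact Real.add_one_le_exp _

variable {ι E : Type*} [NormedAddCommGroup E] [InnerProductSpace ℝ E]

theorem integrable_comp_of_continuous_of_bounded {Z : ι → Ω → ℝ} (hZ : ∀ p, Measurable (Z p))
    {s : Finset ι} {R : ℝ} (hR : ∀ p ω, |Z p ω| ≤ R) {F : (s → ℝ) → ℝ} (hF : Measurable F) {C : ℝ}
    (hC : ∀ z : s → ℝ, (∀ p, |z p| ≤ R) → |F z| ≤ C) :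
    Integrable (fun ω => F fun p => Z p ω) P :=
  Integrable.of_bound (hF.comp (measurable_pi_lambda _ fun p => hZ p)).aestronglyMeasurable C
    (ae_of_all _ fun ω => hC _ fun p => hR p ω)

theorem norm_sum_smul_le {s : Finset ι} {w : ι → E} (hw : ∀ p, ‖w p‖ = 1) {R : ℝ} {z : s → ℝ}
    (hz : ∀ p, |z p| ≤ R) : ‖∑ p, z p • w p‖ ≤ s.card * R := by
  refine (norm_sum_le _ _).trans ((Finset.sum_le_sum fun p _ => ?_).trans
    (by rw [Finset.sum_const, Finset.card_univ, Fintype.card_coe, nsmul_eq_mul]))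
  rw [norm_smul, hw, mul_one]
  exact hz p

/-- Exponential moment bound for the norm of a sum of independent random multiples of fixed unit
vectors. -/
theorem integral_cosh_norm_sum_le {Z : ι → Ω → ℝ} (hZ : ∀ p, Measurable (Z p))
    (hind : iIndepFun Z P) {R : ℝ} (hR : ∀ p ω, |Z p ω| ≤ R) {K : ℝ}
    (hK : ∀ p, ∫ ω, Real.exp (Z p ω) ∂P ≤ K) (hK' : ∀ p, ∫ ω, Real.exp (-Z p ω) ∂P ≤ K)
    (w : ι → E) (hw : ∀ p, ‖w p‖ = 1) (s : Finset ι) :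
    Integrable (fun ω => Real.cosh ‖∑ p ∈ s, Z p ω • w p‖) P ∧
      ∫ ω, Real.cosh ‖∑ p ∈ s, Z p ω • w p‖ ∂P ≤ K ^ s.card := by
  classical
  have hint : ∀ s : Finset ι, Integrable (fun ω => Real.cosh ‖∑ p ∈ s, Z p ω • w p‖) P := by
    intro s
    have hF : Measurable fun z : s → ℝ => Real.cosh ‖∑ p, z p • w p‖ := by
      apply Continuous.measurable
      fun_prop
    have := integrable_comp_of_continuous_of_bounded (P := P) hZ (s := s) hR hF
      (C := Real.cosh (s.card * R)) fun z hz => by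
        rw [abs_of_pos (Real.cosh_pos _), Real.cosh_le_cosh, abs_norm]
        exact (norm_sum_smul_le hw hz).trans (le_abs_self _)
    simpa only [fun ω => Finset.sum_coe_sort s fun p => Z p ω • w p] using this
  refine ⟨hint s, ?_⟩
  induction s using Finset.induction_on with
  | empty => simp
  | insert q s hq ih =>
    set A : (s → ℝ) → ℝ := fun z => Real.cosh ‖∑ p, z p • w p‖ with hA
    set B : (s → ℝ) → ℝ := fun z =>
      inner ℝ (∑ p, z p • w p) (w q) / ‖∑ p, z p • w p‖ * Real.sinh ‖∑ p, z p • w p‖ with hB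
    have hAm : Measurable A := Continuous.measurable (by fun_prop)
    have hBm : Measurable B := by
      refine Measurable.mul (Measurable.div ?_ ?_) ?_ <;>
        exact Continuous.measurable (by fun_prop)
    have hBA : ∀ z, |B z| ≤ A z := fun z => by
      rw [hB, hA, abs_mul]
      refine (mul_le_of_le_one_left (abs_nonneg _)
        (abs_inner_div_norm_le_one _ _ (hw q))).trans ?_
      rw [abs_of_nonneg (Real.sinh_nonneg_iff.2 (norm_nonneg _))]
      exact (Real.sinh_lt_cosh _).le
    have hAC : ∀ z : s → ℝ, (∀ p, |z p| ≤ R) → |A z| ≤ Real.cosh (s.card * R) := fun z hz => by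
      rw [abs_of_pos (Real.cosh_pos _), Real.cosh_le_cosh, abs_norm]
      exact (norm_sum_smul_le hw hz).trans (le_abs_self _)
    have hAi := integrable_comp_of_continuous_of_bounded (P := P) hZ (s := s) hR hAm hAC
    have hBi := integrable_comp_of_continuous_of_bounded (P := P) hZ (s := s) hR hBm
      fun z hz => (hBA z).trans ((le_abs_self _).trans (hAC z hz))
    have hexpi : ∀ a : ℝ, |a| ≤ 1 → Integrable (fun ω => Real.exp (a * Z q ω)) P := fun a ha =>
      Integrable.of_bound ((hZ q).const_mul a).exp.aestronglyMeasurable (Real.exp R)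
        (ae_of_all _ fun ω => by
          rw [Real.norm_eq_abs, Real.abs_exp, Real.exp_le_exp]
          refine (le_abs_self _).trans ?_
          rw [abs_mul]
          exact (mul_le_of_le_one_left (abs_nonneg _) ha).trans (hR q ω))
    have hep : Integrable (fun ω => Real.exp (Z q ω)) P := by simpa using hexpi 1 (by simp)
    have hem : Integrable (fun ω => Real.exp (-Z q ω)) P := by simpa using hexpi (-1) (by simp)
    have hci : Integrable (fun ω => Real.cosh (Z q ω)) P := by
      simp only [Real.cosh_eq]
      exact (hep.add hem).div_const 2
    have hsi : Integrable (fun ω => Real.sinh (Z q ω)) P := by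
      simp only [Real.sinh_eq]
      exact (hep.sub hem).div_const 2
    -- E cosh Z + |E sinh Z| is the larger of E exp Z and E exp(-Z), so no factor 2 is lost per
    -- summand.
    have hcs : (∫ ω, Real.cosh (Z q ω) ∂P) + |∫ ω, Real.sinh (Z q ω) ∂P| ≤ K := by
      have h1 : (∫ ω, Real.cosh (Z q ω) ∂P) + ∫ ω, Real.sinh (Z q ω) ∂P ≤ K := by
        rw [← integral_add hci hsi]
        simpa only [Real.cosh_add_sinh] using hK q
      have h2 : (∫ ω, Real.cosh (Z q ω) ∂P) - ∫ ω, Real.sinh (Z q ω) ∂P ≤ K := by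
        rw [← integral_sub hci hsi]
        simpa only [Real.cosh_sub_sinh] using hK' q
      rcases abs_cases (∫ ω, Real.sinh (Z q ω) ∂P) with h | h <;> linarith
    have hK0 : 0 ≤ K := (integral_nonneg fun ω => (Real.exp_pos _).le).trans (hK q)
    have hI : IndepFun (fun ω (p : s) => Z p ω) (Z q) P :=
      (hind.indepFun_finset s {q} (by simpa using hq) hZ).comp measurable_id
        (measurable_pi_apply (⟨q, Finset.mem_singleton_self q⟩ : ({q} : Finset ι)))
    have hIA : IndepFun (fun ω => A fun p => Z p ω) (fun ω => Real.cosh (Z q ω)) P :=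
      hI.comp hAm Real.measurable_cosh
    have hIB : IndepFun (fun ω => B fun p => Z p ω) (fun ω => Real.sinh (Z q ω)) P :=
      hI.comp hBm Real.measurable_sinh
    have hsum : ∀ ω, ∑ p : s, Z p ω • w p = ∑ p ∈ s, Z p ω • w p := fun ω =>
      Finset.sum_coe_sort s fun p => Z p ω • w p
    have hAK : ∫ ω, A (fun p => Z p ω) ∂P ≤ K ^ s.card := by
      simpa only [hA, hsum] using ih
    have hBA' : |∫ ω, B (fun p => Z p ω) ∂P| ≤ ∫ ω, A (fun p => Z p ω) ∂P :=
      abs_integral_le_integral_abs.trans (integral_mono hBi.abs hAi fun ω => hBA _)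
    have hABi : Integrable (fun ω => A (fun p => Z p ω) * Real.cosh (Z q ω)) P :=
      hIA.integrable_mul hAi hci
    have hBBi : Integrable (fun ω => B (fun p => Z p ω) * Real.sinh (Z q ω)) P :=
      hIB.integrable_mul hBi hsi
    rw [Finset.card_insert_of_notMem hq]
    -- Independence factors both products, and |B| ≤ A lets E A be pulled out of the sum.
    calc ∫ ω, Real.cosh ‖∑ p ∈ insert q s, Z p ω • w p‖ ∂P
        ≤ ∫ ω, (A (fun p => Z p ω) * Real.cosh (Z q ω)
            + B (fun p => Z p ω) * Real.sinh (Z q ω)) ∂P := by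
          refine integral_mono (hint _) (hABi.add hBBi) fun ω => ?_
          have := cosh_norm_add_smul_le (∑ p ∈ s, Z p ω • w p) (w q) (hw q) (Z q ω)
          simp only [hA, hB, hsum]
          rwa [Finset.sum_insert hq, add_comm]
      _ = (∫ ω, A (fun p => Z p ω) ∂P) * (∫ ω, Real.cosh (Z q ω) ∂P)
            + (∫ ω, B (fun p => Z p ω) ∂P) * ∫ ω, Real.sinh (Z q ω) ∂P := by
          rw [integral_add hABi hBBi,
            hIA.integral_fun_mul_eq_mul_integral hAi.1 hci.1,
            hIB.integral_fun_mul_eq_mul_integral hBi.1 hsi.1]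
      _ ≤ (∫ ω, A (fun p => Z p ω) ∂P) *
            ((∫ ω, Real.cosh (Z q ω) ∂P) + |∫ ω, Real.sinh (Z q ω) ∂P|) := by
          rw [mul_add]
          refine add_le_add_right ((le_abs_self _).trans ?_) _
          rw [abs_mul]
          exact mul_le_mul_of_nonneg_right hBA' (abs_nonneg _)
      _ ≤ K ^ s.card * K :=
          mul_le_mul hAK hcs (add_nonneg (integral_nonneg fun ω => (Real.cosh_pos _).le)
            (abs_nonneg _)) (pow_nonneg hK0 _)
      _ = K ^ (s.card + 1) := (pow_succ _ _).symm

end Probability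

/-! ### Spectral norm through bilinear forms. -/

section OpNorm
variable {m n : Type*} [Fintype m] [Fintype n] [DecidableEq n]

theorem l2_opNorm_le_of_bilin_le {A : Matrix m n ℝ} {C : ℝ} (hC : 0 ≤ C)
    (h : ∀ (x : n → ℝ) (u : m → ℝ), ∑ j, x j ^ 2 = 1 → ∑ i, u i ^ 2 = 1 →
      ∑ i, u i * ∑ j, A i j * x j ≤ C) : ‖A‖ ≤ C := by
  rw [Matrix.l2_opNorm_def]
  refine ContinuousLinearMap.opNorm_le_of_re_inner_le hC fun x u hx hu => ?_
  have hx' : ∑ j, x j ^ 2 = 1 := by rw [← EuclideanSpace.real_norm_sq_eq, hx, one_pow]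
  have hu' : ∑ i, u i ^ 2 = 1 := by rw [← EuclideanSpace.real_norm_sq_eq, hu, one_pow]
  exact h x u hx' hu'

theorem l2_opNorm_sq_le_sum_sq (A : Matrix m n ℝ) : ‖A‖ ^ 2 ≤ ∑ i, ∑ j, A i j ^ 2 := by
  have h0 : 0 ≤ ∑ i, ∑ j, A i j ^ 2 := by positivity
  rw [← Real.sqrt_le_sqrt_iff h0, Real.sqrt_sq (norm_nonneg A)]
  refine l2_opNorm_le_of_bilin_le (Real.sqrt_nonneg _) fun x u hx hu => Real.le_sqrt_of_sq_le ?_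
  calc (∑ i, u i * ∑ j, A i j * x j) ^ 2
      ≤ (∑ i, u i ^ 2) * ∑ i, (∑ j, A i j * x j) ^ 2 := Finset.sum_mul_sq_le_sq_mul_sq _ _ _
    _ = ∑ i, (∑ j, A i j * x j) ^ 2 := by rw [hu, one_mul]
    _ ≤ ∑ i, ∑ j, A i j ^ 2 := Finset.sum_le_sum fun i _ => by
        refine (Finset.sum_mul_sq_le_sq_mul_sq _ _ _).trans ?_
        rw [hx, mul_one]

end OpNorm

/-! ### Hankel matrices and the discrete Fourier transform. -/

section Fourier

theorem IsPrimitiveRoot.sum_pow_mul_conj_pow {n : ℕ} {ζ : ℂ} (hζ : IsPrimitiveRoot ζ n)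
    {a b : ℕ} (ha : a < n) (hb : b < n) :
    ∑ k ∈ Finset.range n, ζ ^ (k * a) * starRingEnd ℂ (ζ ^ (k * b)) = if a = b then (n : ℂ) else 0 := by
  have hn : n ≠ 0 := by omega
  have h1 : ‖ζ‖ = 1 := hζ.norm'_eq_one hn
  have hζ0 : ζ ≠ 0 := hζ.ne_zero hn
  have hconj : starRingEnd ℂ ζ = ζ⁻¹ := (Complex.inv_eq_conj h1).symm
  have hterm : ∀ k, ζ ^ (k * a) * starRingEnd ℂ (ζ ^ (k * b)) = (ζ ^ a * (ζ ^ b)⁻¹) ^ k := fun k => by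
    rw [map_pow, hconj, mul_pow, ← inv_pow, ← pow_mul, ← pow_mul, mul_comm a, mul_comm b]
  simp only [hterm]
  split_ifs with hab
  · subst hab
    rw [mul_inv_cancel₀ (pow_ne_zero _ hζ0)]
    simp
  · have hne : ζ ^ a * (ζ ^ b)⁻¹ ≠ 1 := fun h => hab <| hζ.pow_inj ha hb <| by
      rwa [mul_inv_eq_one₀ (pow_ne_zero _ hζ0)] at h
    rw [geom_sum_eq hne, mul_pow, inv_pow, ← pow_mul, ← pow_mul, mul_comm a, mul_comm b, pow_mul,
      pow_mul, hζ.pow_eq_one]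
    simp

/-- Parseval for a vector padded with zeros to length `n`. -/
theorem IsPrimitiveRoot.sum_norm_sq_sum_smul_pow {n l : ℕ} {ζ : ℂ} (hζ : IsPrimitiveRoot ζ n)
    (hl : l ≤ n) (u : Fin l → ℝ) :
    ∑ k ∈ Finset.range n, ‖∑ i, u i • ζ ^ (k * (i : ℕ))‖ ^ 2 = n * ∑ i, u i ^ 2 := by
  have key : ∀ k, ((‖∑ i, u i • ζ ^ (k * (i : ℕ))‖ ^ 2 : ℝ) : ℂ) =
      ∑ i, ∑ j, (u i * u j : ℂ) * (ζ ^ (k * (i : ℕ)) * starRingEnd ℂ (ζ ^ (k * (j : ℕ)))) := fun k => by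
    rw [Complex.ofReal_pow, ← Complex.mul_conj', map_sum, Finset.sum_mul_sum]
    refine Finset.sum_congr rfl fun i _ => Finset.sum_congr rfl fun j _ => ?_
    simp only [Complex.real_smul, map_mul, Complex.conj_ofReal]
    ring
  apply Complex.ofReal_injective
  rw [Complex.ofReal_sum, Finset.sum_congr rfl fun k _ => key k, Finset.sum_comm]
  have : ∀ i : Fin l, ∑ k ∈ Finset.range n, ∑ j : Fin l,
      (u i * u j : ℂ) * (ζ ^ (k * (i : ℕ)) * starRingEnd ℂ (ζ ^ (k * (j : ℕ)))) =
      (n : ℂ) * (u i : ℂ) ^ 2 := fun i => by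
    rw [Finset.sum_comm]
    have h2 : ∀ j : Fin l, ∑ k ∈ Finset.range n,
        (u i * u j : ℂ) * (ζ ^ (k * (i : ℕ)) * starRingEnd ℂ (ζ ^ (k * (j : ℕ)))) =
        if i = j then (n : ℂ) * (u i : ℂ) ^ 2 else 0 := fun j => by
      rw [← Finset.mul_sum, hζ.sum_pow_mul_conj_pow (i.2.trans_le hl) (j.2.trans_le hl)]
      simp only [← Fin.ext_iff]
      split_ifs with h
      · subst h; ring
      · simp
    simp only [h2, Finset.sum_ite_eq, Finset.mem_univ, if_true]
  rw [Finset.sum_congr rfl fun i _ => this i, ← Finset.mul_sum]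
  push_cast
  rfl

/-- Orthogonality of characters selects m ≡ i + j modulo `M + 1`, which is m = i + j because `i + j
≤ M`. -/
theorem IsPrimitiveRoot.bilin_hankel_eq {M L : ℕ} (hL : L ≤ M) {ζ : ℂ}
    (hζ : IsPrimitiveRoot ζ (M + 1)) (y : Fin (M + 1) → ℝ) (x : Fin (M - L + 1) → ℝ)
    (u : Fin (L + 1) → ℝ) :
    ((M + 1 : ℕ) : ℂ) * ((∑ i, u i * ∑ j, hankel L hL y i j * x j : ℝ) : ℂ) =
      ∑ k ∈ Finset.range (M + 1), (∑ m, y m • ζ ^ (k * (m : ℕ))) *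
        starRingEnd ℂ ((∑ i, u i • ζ ^ (k * (i : ℕ))) * ∑ j, x j • ζ ^ (k * (j : ℕ))) := by
  have key : ∀ k, (∑ m, y m • ζ ^ (k * (m : ℕ))) *
        starRingEnd ℂ ((∑ i, u i • ζ ^ (k * (i : ℕ))) * ∑ j, x j • ζ ^ (k * (j : ℕ))) =
      ∑ i, ∑ j, ∑ m, (u i * x j * y m : ℂ) *
        (ζ ^ (k * (m : ℕ)) * starRingEnd ℂ (ζ ^ (k * ((i : ℕ) + (j : ℕ))))) := fun k => by
    rw [Finset.sum_mul_sum, map_sum, Finset.mul_sum]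
    refine Finset.sum_congr rfl fun i _ => ?_
    rw [map_sum, Finset.mul_sum]
    refine Finset.sum_congr rfl fun j _ => ?_
    rw [Finset.sum_mul]
    refine Finset.sum_congr rfl fun m _ => ?_
    simp only [Complex.real_smul, map_mul, Complex.conj_ofReal, mul_add, pow_add]
    ring
  rw [Finset.sum_congr rfl fun k _ => key k, Finset.sum_comm, Complex.ofReal_sum, Finset.mul_sum]
  refine Finset.sum_congr rfl fun i _ => ?_
  rw [Finset.sum_comm, Finset.mul_sum, Complex.ofReal_sum, Finset.mul_sum]
  refine Finset.sum_congr rfl fun j _ => ?_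
  rw [Finset.sum_comm]
  have hij : (i : ℕ) + (j : ℕ) < M + 1 := by omega
  have h2 : ∀ m : Fin (M + 1), ∑ k ∈ Finset.range (M + 1), (u i * x j * y m : ℂ) *
        (ζ ^ (k * (m : ℕ)) * starRingEnd ℂ (ζ ^ (k * ((i : ℕ) + (j : ℕ))))) =
      if m = ⟨(i : ℕ) + (j : ℕ), hij⟩ then (u i * x j * y m : ℂ) * ((M + 1 : ℕ) : ℂ) else 0 :=
    fun m => by
      rw [← Finset.mul_sum, hζ.sum_pow_mul_conj_pow m.2 hij, mul_ite, mul_zero]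
      simp only [Fin.ext_iff]
  simp only [h2, Finset.sum_ite_eq', Finset.mem_univ, if_true, hankel, Matrix.of_apply]
  push_cast
  ring

theorem IsPrimitiveRoot.l2_opNorm_hankel_le {M L : ℕ} (hL : L ≤ M) {ζ : ℂ}
    (hζ : IsPrimitiveRoot ζ (M + 1)) (y : Fin (M + 1) → ℝ) {C : ℝ}
    (hC : ∀ k < M + 1, ‖∑ m, y m • ζ ^ (k * (m : ℕ))‖ ≤ C) : ‖hankel L hL y‖ ≤ C := by
  have hC0 : 0 ≤ C := (norm_nonneg _).trans (hC 0 (Nat.succ_pos M))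
  refine l2_opNorm_le_of_bilin_le hC0 fun x u hx hu => ?_
  have hM : (0 : ℝ) < (M + 1 : ℕ) := by positivity
  refine le_of_mul_le_mul_left ?_ hM
  have hU := hζ.sum_norm_sq_sum_smul_pow (l := L + 1) (by omega) u
  have hX := hζ.sum_norm_sq_sum_smul_pow (l := M - L + 1) (by omega) x
  rw [hu, mul_one] at hU
  rw [hx, mul_one] at hX
  calc ((M + 1 : ℕ) : ℝ) * ∑ i, u i * ∑ j, hankel L hL y i j * x j
      ≤ ‖((M + 1 : ℕ) : ℂ) * ((∑ i, u i * ∑ j, hankel L hL y i j * x j : ℝ) : ℂ)‖ := by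
        rw [norm_mul, Complex.norm_natCast, Complex.norm_real, Real.norm_eq_abs]
        exact mul_le_mul_of_nonneg_left (le_abs_self _) hM.le
    -- AM-GM separates the transforms of `u` and `x`, so that Parseval applies to each.
    _ ≤ ∑ k ∈ Finset.range (M + 1), C * ((‖∑ i, u i • ζ ^ (k * (i : ℕ))‖ ^ 2
          + ‖∑ j, x j • ζ ^ (k * (j : ℕ))‖ ^ 2) / 2) := by
        rw [hζ.bilin_hankel_eq hL]
        refine (norm_sum_le _ _).trans (Finset.sum_le_sum fun k hk => ?_)
        rw [norm_mul, RCLike.norm_conj, norm_mul]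
        refine mul_le_mul (hC k (Finset.mem_range.1 hk)) ?_ (by positivity) hC0
        linarith [two_mul_le_add_sq ‖∑ i, u i • ζ ^ (k * (i : ℕ))‖ ‖∑ j, x j • ζ ^ (k * (j : ℕ))‖]
    _ = ((M + 1 : ℕ) : ℝ) * C := by
        rw [← Finset.mul_sum, ← Finset.sum_div, Finset.sum_add_distrib, hU, hX]
        ring

/-- For real data the transform at n - k is the complex conjugate of that at k; this halves the
number of frequencies. -/
theorem IsPrimitiveRoot.norm_sum_smul_pow_sub {n : ℕ} {ζ : ℂ} (hζ : IsPrimitiveRoot ζ n)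
    (hn : n ≠ 0) (y : Fin n → ℝ) {k : ℕ} (hk : k ≤ n) :
    ‖∑ m, y m • ζ ^ ((n - k) * (m : ℕ))‖ = ‖∑ m, y m • ζ ^ (k * (m : ℕ))‖ := by
  have hζ0 : ζ ≠ 0 := hζ.ne_zero hn
  have hconj : starRingEnd ℂ ζ = ζ⁻¹ := (Complex.inv_eq_conj (hζ.norm'_eq_one hn)).symm
  rw [← RCLike.norm_conj (∑ m, y m • ζ ^ (k * (m : ℕ))), map_sum]
  congr 1
  refine Finset.sum_congr rfl fun m _ => ?_
  simp only [Complex.real_smul, map_mul, Complex.conj_ofReal, map_pow, hconj]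
  congr 1
  rw [pow_mul, pow_mul, pow_sub₀ ζ hζ0 hk, hζ.pow_eq_one, one_mul]
  simp only [inv_pow]

/-- The spectral norm of a square Hankel matrix is at most the modulus of one of the values of the
discrete Fourier transform, at a frequency in the lower half of the range. -/
theorem IsPrimitiveRoot.exists_l2_opNorm_hankel_le {L : ℕ} (hL : L ≤ 2 * L) {ζ : ℂ}
    (hζ : IsPrimitiveRoot ζ (2 * L + 1)) (y : Fin (2 * L + 1) → ℝ) :
    ∃ k ∈ Finset.range (L + 1), ‖hankel L hL y‖ ≤ ‖∑ m, y m • ζ ^ (k * (m : ℕ))‖ := by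
  obtain ⟨k, hk, hmax⟩ := Finset.exists_max_image (Finset.range (L + 1))
    (fun k => ‖∑ m, y m • ζ ^ (k * (m : ℕ))‖) ⟨0, by simp⟩
  refine ⟨k, hk, hζ.l2_opNorm_hankel_le hL y fun l hl => ?_⟩
  by_cases h : l < L + 1
  · exact hmax l (Finset.mem_range.2 h)
  · have h2 := hζ.norm_sum_smul_pow_sub (by omega) y (k := 2 * L + 1 - l) (by omega)
    rw [Nat.sub_sub_self hl.le] at h2
    rw [h2]
    exact hmax _ (Finset.mem_range.2 (by omega))

theorem IsPrimitiveRoot.exp_l2_opNorm_hankel_le {L : ℕ} (hL : L ≤ 2 * L) {ζ : ℂ}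
    (hζ : IsPrimitiveRoot ζ (2 * L + 1)) (y : Fin (2 * L + 1) → ℝ) :
    Real.exp ‖hankel L hL y‖ ≤
      2 * ∑ k ∈ Finset.range (L + 1), Real.cosh ‖∑ m, y m • ζ ^ (k * (m : ℕ))‖ := by
  obtain ⟨k, hk, h⟩ := hζ.exists_l2_opNorm_hankel_le hL y
  have h1 := Finset.single_le_sum (f := fun k => Real.cosh ‖∑ m, y m • ζ ^ (k * (m : ℕ))‖)
    (fun i _ => (Real.cosh_pos _).le) hk
  have h2 : Real.exp ‖hankel L hL y‖ ≤ Real.exp ‖∑ m, y m • ζ ^ (k * (m : ℕ))‖ :=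
    Real.exp_le_exp.2 h
  have h3 := Real.cosh_eq ‖∑ m, y m • ζ ^ (k * (m : ℕ))‖
  have h4 := Real.exp_pos (-‖∑ m, y m • ζ ^ (k * (m : ℕ))‖)
  linarith

end Fourier

/-! ### The 2 × 2 Hankel matrix. -/

/-- Split the symmetric matrix into its scalar part and its trace-free part; the latter has
eigenvalues ± the square root. -/
theorem l2_opNorm_hankel_one_le (hL : 1 ≤ 2) (y : Fin 3 → ℝ) :
    ‖hankel 1 hL y‖ ≤
      |(y 0 + y 2) / 2| + Real.sqrt (((y 0 - y 2) / 2) ^ 2 + y 1 ^ 2) := by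
  refine l2_opNorm_le_of_bilin_le (by positivity) fun x u hx hu => ?_
  change ∑ j : Fin 2, x j ^ 2 = 1 at hx
  change ∑ i : Fin 2, u i ^ 2 = 1 at hu
  change ∑ i : Fin 2, u i * ∑ j : Fin 2, hankel 1 hL y i j * x j ≤ _
  have h00 : hankel 1 hL y (0 : Fin 2) (0 : Fin 2) = y 0 := rfl
  have h01 : hankel 1 hL y (0 : Fin 2) (1 : Fin 2) = y 1 := rfl
  have h10 : hankel 1 hL y (1 : Fin 2) (0 : Fin 2) = y 1 := rfl
  have h11 : hankel 1 hL y (1 : Fin 2) (1 : Fin 2) = y 2 := rfl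
  simp only [Fin.sum_univ_two] at hx hu ⊢
  rw [h00, h01, h10, h11]
  generalize y 0 = a, y 1 = b, y 2 = c, x (0 : Fin 2) = x0, x (1 : Fin 2) = x1,
    u (0 : Fin 2) = u0, u (1 : Fin 2) = u1 at *
  have h1 : (a + c) / 2 * (u0 * x0 + u1 * x1) ≤ |(a + c) / 2| := by
    refine (le_abs_self _).trans ?_
    rw [abs_mul]
    refine mul_le_of_le_one_right (abs_nonneg _) (abs_le.2 ⟨?_, ?_⟩) <;>
      nlinarith [sq_nonneg (u0 + x0), sq_nonneg (u1 + x1), sq_nonneg (u0 - x0), sq_nonneg (u1 - x1)]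
  have h2 : (a - c) / 2 * (u0 * x0 - u1 * x1) + b * (u0 * x1 + u1 * x0) ≤
      Real.sqrt (((a - c) / 2) ^ 2 + b ^ 2) := by
    refine Real.le_sqrt_of_sq_le ?_
    have h3 : (u0 * x0 - u1 * x1) ^ 2 + (u0 * x1 + u1 * x0) ^ 2 = 1 := by
      linear_combination (u0 ^ 2 + u1 ^ 2) * hx + hu
    have h4 := sq_nonneg ((a - c) / 2 * (u0 * x1 + u1 * x0) - b * (u0 * x0 - u1 * x1))
    have h5 : ((a - c) / 2 * (u0 * x0 - u1 * x1) + b * (u0 * x1 + u1 * x0)) ^ 2 +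
        ((a - c) / 2 * (u0 * x1 + u1 * x0) - b * (u0 * x0 - u1 * x1)) ^ 2 =
        ((a - c) / 2) ^ 2 + b ^ 2 := by
      linear_combination (((a - c) / 2) ^ 2 + b ^ 2) * h3
    linarith
  linarith

theorem exp_abs_le_two_mul_cosh (x : ℝ) : Real.exp |x| ≤ 2 * Real.cosh x := by
  rw [← Real.cosh_abs x, Real.cosh_eq]
  linarith [Real.exp_pos (-|x|)]

/-- Each cosh involves only two of the three entries, so the variance factor becomes 2v = Mv, where
the Fourier bound would give 3v. -/
theorem exp_l2_opNorm_hankel_one_le (hL : 1 ≤ 2) (y : Fin 3 → ℝ) :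
    Real.exp ‖hankel 1 hL y‖ ≤ Real.cosh (y 0 + y 1) + Real.cosh (y 0 - y 1)
      + Real.cosh (y 2 + y 1) + Real.cosh (y 2 - y 1) := by
  set r := Real.sqrt (((y 0 - y 2) / 2) ^ 2 + y 1 ^ 2) with hr
  have h1 := exp_abs_le_two_mul_cosh ((y 0 + y 2) / 2)
  have h2 := exp_abs_le_two_mul_cosh r
  rw [abs_of_nonneg (Real.sqrt_nonneg _)] at h2
  have h3 : Real.cosh r ≤ _ := cosh_sqrt_add_sq_le ((y 0 - y 2) / 2) (y 1)
  have h4 : 2 * Real.cosh ((y 0 + y 2) / 2) * Real.cosh ((y 0 - y 2) / 2) =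
      Real.cosh (y 0) + Real.cosh (y 2) := by
    have e0 : y 0 = (y 0 + y 2) / 2 + (y 0 - y 2) / 2 := by ring
    have e2 : y 2 = (y 0 + y 2) / 2 - (y 0 - y 2) / 2 := by ring
    have c0 := Real.cosh_add ((y 0 + y 2) / 2) ((y 0 - y 2) / 2)
    have c2 := Real.cosh_sub ((y 0 + y 2) / 2) ((y 0 - y 2) / 2)
    rw [← e0] at c0
    rw [← e2] at c2
    linarith
  calc Real.exp ‖hankel 1 hL y‖ ≤ Real.exp (|(y 0 + y 2) / 2| + r) :=
        Real.exp_le_exp.2 (l2_opNorm_hankel_one_le hL y)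
    _ = Real.exp |(y 0 + y 2) / 2| * Real.exp r := Real.exp_add _ _
    _ ≤ (2 * Real.cosh ((y 0 + y 2) / 2)) *
          (2 * (Real.cosh ((y 0 - y 2) / 2) * Real.cosh (y 1))) :=
        mul_le_mul h1 (h2.trans (by linarith)) (Real.exp_pos _).le
          (mul_nonneg two_pos.le (Real.cosh_pos _).le)
    _ = 2 * (2 * Real.cosh ((y 0 + y 2) / 2) * Real.cosh ((y 0 - y 2) / 2)) * Real.cosh (y 1) := by
        ring
    _ = _ := by
        rw [h4, Real.cosh_add, Real.cosh_sub, Real.cosh_add, Real.cosh_sub]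
        ring

/-- A family of independent centered random variables with values in `[-1, 1]` and second moment at
most `v`. -/
structure IsBoundedCenteredIndep {Ω ι : Type*} [MeasurableSpace Ω] (X : ι → Ω → ℝ) (v : ℝ)
    (P : Measure Ω) : Prop where
  measurable : ∀ p, Measurable (X p)
  abs_le_one : ∀ p ω, |X p ω| ≤ 1
  integral_eq_zero : ∀ p, ∫ ω, X p ω ∂P = 0
  integral_sq_le : ∀ p, ∫ ω, X p ω ^ 2 ∂P ≤ v
  indep : iIndepFun X P

/-! ### Moment and tail bounds for random Hankel matrices. -/

namespace IsBoundedCenteredIndep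

variable {Ω ι E : Type*} [MeasurableSpace Ω] {P : Measure Ω} [IsProbabilityMeasure P]
  [NormedAddCommGroup E] [InnerProductSpace ℝ E]

theorem integral_cosh_norm_sum_le {X : ι → Ω → ℝ} {v μ : ℝ} (hX : IsBoundedCenteredIndep X v P)
    (hμ0 : 0 ≤ μ) (hμ : μ < 3) (w : ι → E) (hw : ∀ p, ‖w p‖ = 1) (s : Finset ι) :
    Integrable (fun ω => Real.cosh ‖∑ p ∈ s, (μ * X p ω) • w p‖) P ∧
      ∫ ω, Real.cosh ‖∑ p ∈ s, (μ * X p ω) • w p‖ ∂P ≤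
        Real.exp (v * (μ ^ 2 / (2 * (1 - μ / 3)))) ^ s.card := by
  refine _root_.integral_cosh_norm_sum_le (Z := fun p ω => μ * X p ω) (R := μ)
    (fun p => (hX.measurable p).const_mul μ)
    (hX.indep.comp (fun _ x => μ * x) fun _ => measurable_const_mul μ) (fun p ω => ?_)
    (fun p => ?_) (fun p => ?_) w hw s
  · rw [abs_mul, abs_of_nonneg hμ0]
    exact mul_le_of_le_one_right hμ0 (hX.abs_le_one p ω)
  · exact integral_exp_mul_le (hX.measurable p) (hX.abs_le_one p) (hX.integral_eq_zero p)
      (hX.integral_sq_le p) (abs_of_nonneg hμ0).le hμ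
  · simp only [← neg_mul]
    exact integral_exp_mul_le (hX.measurable p) (hX.abs_le_one p) (hX.integral_eq_zero p)
      (hX.integral_sq_le p) (by rw [abs_neg, abs_of_nonneg hμ0]) hμ

theorem integral_sum_sq_le {X : ι → Ω → ℝ} {v : ℝ} (hX : IsBoundedCenteredIndep X v P)
    (s : Finset ι) :
    Integrable (fun ω => (∑ p ∈ s, X p ω) ^ 2) P ∧ ∫ ω, (∑ p ∈ s, X p ω) ^ 2 ∂P ≤ s.card * v := by
  have hm : ∀ p, MemLp (X p) 2 P := fun p =>
    MemLp.of_bound (hX.measurable p).aestronglyMeasurable 1 (ae_of_all _ (hX.abs_le_one p))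
  have hms : MemLp (∑ p ∈ s, X p) 2 P := memLp_finsetSum' s fun p _ => hm p
  have hsum : ∀ ω, ∑ p ∈ s, X p ω = (∑ p ∈ s, X p) ω := fun ω => (Finset.sum_apply ω s X).symm
  simp only [hsum]
  refine ⟨hms.integrable_sq, ?_⟩
  have h0 : ∫ ω, (∑ p ∈ s, X p) ω ∂P = 0 := by
    simp only [Finset.sum_apply]
    rw [integral_finsetSum s fun p _ => (hm p).integrable one_le_two]
    exact Finset.sum_eq_zero fun p _ => hX.integral_eq_zero p
  rw [← variance_of_integral_eq_zero hms.1.aemeasurable h0,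
    IndepFun.variance_sum (fun p _ => hm p) fun p _ q _ hpq => hX.indep.indepFun hpq]
  refine (Finset.sum_le_sum fun p _ => ?_).trans (by rw [Finset.sum_const, nsmul_eq_mul])
  rw [variance_of_integral_eq_zero (hX.measurable p).aemeasurable (hX.integral_eq_zero p)]
  exact hX.integral_sq_le p

theorem exists_exp_hankel_le {N L : ℕ} (hL : L ≤ 2 * L)
    {X : Fin N × Fin (2 * L + 1) → Ω → ℝ} {v μ : ℝ} (hX : IsBoundedCenteredIndep X v P)
    (hμ0 : 0 ≤ μ) (hμ : μ < 3) :
    ∃ G : Ω → ℝ, Integrable G P ∧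
      (∀ ω, Real.exp ‖hankel L hL fun m => ∑ i, μ * X (i, m) ω‖ ≤ G ω) ∧
      ∫ ω, G ω ∂P ≤ (2 * L + 2) *
        Real.exp (v * (μ ^ 2 / (2 * (1 - μ / 3)))) ^ (N * (2 * L + 1)) := by
  have hζ := Complex.isPrimitiveRoot_exp (2 * L + 1) (by omega)
  set ζ := Complex.exp (2 * Real.pi * Complex.I / (2 * L + 1 : ℕ))
  have h := fun k : ℕ => hX.integral_cosh_norm_sum_le hμ0 hμ (fun p => ζ ^ (k * (p.2 : ℕ)))
    (fun p => by rw [norm_pow, hζ.norm'_eq_one (by omega), one_pow]) Finset.univ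
  refine ⟨fun ω => 2 * ∑ k ∈ Finset.range (L + 1),
    Real.cosh ‖∑ p, (μ * X p ω) • ζ ^ (k * (p.2 : ℕ))‖,
    (integrable_finsetSum _ fun k _ => (h k).1).const_mul 2, fun ω => ?_, ?_⟩
  · refine (hζ.exp_l2_opNorm_hankel_le hL _).trans (le_of_eq ?_)
    simp only [Finset.sum_smul, Fintype.sum_prod_type_right]
  · rw [integral_const_mul, integral_finsetSum _ fun k _ => (h k).1]
    have := Finset.sum_le_sum fun k (_ : k ∈ Finset.range (L + 1)) => (h k).2
    rw [Finset.sum_const, Finset.card_range, nsmul_eq_mul, Finset.card_univ, Fintype.card_prod,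
      Fintype.card_fin, Fintype.card_fin] at this
    push_cast at this
    linarith

theorem exists_exp_hankel_one_le {N : ℕ} (hL : 1 ≤ 2)
    {X : Fin N × Fin 3 → Ω → ℝ} {v μ : ℝ} (hX : IsBoundedCenteredIndep X v P)
    (hμ0 : 0 ≤ μ) (hμ : μ < 3) :
    ∃ G : Ω → ℝ, Integrable G P ∧
      (∀ ω, Real.exp ‖hankel 1 hL fun m => ∑ i, μ * X (i, m) ω‖ ≤ G ω) ∧
      ∫ ω, G ω ∂P ≤ 4 * Real.exp (v * (μ ^ 2 / (2 * (1 - μ / 3)))) ^ (N * 2) := by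
  have h : ∀ (a : Fin 3) (σ : ℝ), a ≠ 1 → |σ| = 1 →
      Integrable (fun ω => Real.cosh ((∑ i, μ * X (i, a) ω) + σ * ∑ i, μ * X (i, 1) ω)) P ∧
      ∫ ω, Real.cosh ((∑ i, μ * X (i, a) ω) + σ * ∑ i, μ * X (i, 1) ω) ∂P ≤
        Real.exp (v * (μ ^ 2 / (2 * (1 - μ / 3)))) ^ (N * 2) := by
    intro a σ ha hσ
    -- The unit vectors are the signs `σ` and 1 in ℝ, and only the indices `a` and 1 are kept: `N *
    -- 2` summands.
    have := hX.integral_cosh_norm_sum_le hμ0 hμ (fun p => if p.2 = 1 then σ else 1)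
      (fun p => by split_ifs <;> simp [hσ]) (Finset.univ ×ˢ {a, 1})
    rw [Finset.card_product, Finset.card_pair ha, Finset.card_univ, Fintype.card_fin] at this
    have e : ∀ ω, ∑ p ∈ (Finset.univ : Finset (Fin N)) ×ˢ {a, (1 : Fin 3)},
        (μ * X p ω) • (if p.2 = 1 then σ else 1) =
        (∑ i, μ * X (i, a) ω) + σ * ∑ i, μ * X (i, 1) ω := fun ω => by
      rw [Finset.sum_product_right, Finset.sum_pair ha, Finset.mul_sum]
      simp [ha, mul_comm]
    simpa only [e, Real.norm_eq_abs, Real.cosh_abs] using this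
  have h1 := h 0 1 (by decide) (by simp)
  have h2 := h 0 (-1) (by decide) (by simp)
  have h3 := h 2 1 (by decide) (by simp)
  have h4 := h 2 (-1) (by decide) (by simp)
  have h12 := h1.1.add h2.1
  have h123 := h12.add h3.1
  refine ⟨_, h123.add h4.1, fun ω => ?_, ?_⟩
  · refine (exp_l2_opNorm_hankel_one_le hL _).trans (le_of_eq ?_)
    simp only [Pi.add_apply, one_mul, neg_mul, ← sub_eq_add_neg]
  · rw [integral_add' h123 h4.1, integral_add' h12 h3.1, integral_add' h1.1 h2.1]
    linarith [h1.2, h2.2, h3.2, h4.2]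

theorem hankel_smul {M L : ℕ} (hL : L ≤ M) (c : ℝ) (y : Fin (M + 1) → ℝ) :
    hankel L hL (fun m => c * y m) = c • hankel L hL y := by
  ext i j
  simp [hankel]

/-- Chernoff's argument: Markov's inequality is applied to the integrable majorant `G` at the level
exp(Nμϵ). -/
theorem measureReal_lt_norm_hankel_le_of_exp {N M L : ℕ} (hL : L ≤ M) (hN : 0 < N)
    {X : Fin N × Fin (M + 1) → Ω → ℝ} {μ ϵ B : ℝ} (hμ0 : 0 ≤ μ)
    (hG : ∃ G : Ω → ℝ, Integrable G P ∧
      (∀ ω, Real.exp ‖hankel L hL fun m => ∑ i, μ * X (i, m) ω‖ ≤ G ω) ∧ ∫ ω, G ω ∂P ≤ B) :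
    P.real {ω | ϵ < ‖hankel L hL fun m => 1 / (N : ℝ) * ∑ i, X (i, m) ω‖} ≤
      B * Real.exp (-(N * (μ * ϵ))) := by
  obtain ⟨G, hGi, hle, hB⟩ := hG
  have hN' : (0 : ℝ) < N := by exact_mod_cast hN
  have hmarkov := mul_meas_ge_le_integral_of_nonneg
    (ae_of_all P fun ω => (Real.exp_pos _).le.trans (hle ω)) hGi (Real.exp (N * (μ * ϵ)))
  have hsub : {ω | ϵ < ‖hankel L hL fun m => 1 / (N : ℝ) * ∑ i, X (i, m) ω‖} ⊆
      {ω | Real.exp (N * (μ * ϵ)) ≤ G ω} := fun ω hω => by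
    refine (Real.exp_le_exp.2 ?_).trans (hle ω)
    have e : (fun m => ∑ i, μ * X (i, m) ω) =
        fun m => (N * μ) * (1 / (N : ℝ) * ∑ i, X (i, m) ω) := by
      funext m
      rw [← Finset.mul_sum]
      field_simp
    rw [e, hankel_smul, norm_smul, Real.norm_of_nonneg (by positivity), ← mul_assoc]
    exact mul_le_mul_of_nonneg_left (le_of_lt hω) (by positivity)
  have h2 := (mul_le_mul_of_nonneg_left (measureReal_mono hsub) (Real.exp_pos _).le).trans
    (hmarkov.trans hB)
  rw [Real.exp_neg, ← div_eq_mul_inv, le_div_iff₀ (Real.exp_pos _), mul_comm]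
  exact h2

/-- Bernstein type tail bound for random square Hankel matrices. -/
theorem measureReal_lt_norm_hankel_le {N L : ℕ} (hL : L ≤ 2 * L) (hN : 0 < N)
    {X : Fin N × Fin (2 * L + 1) → Ω → ℝ} {v μ ϵ : ℝ} (hX : IsBoundedCenteredIndep X v P)
    (hμ0 : 0 ≤ μ) (hμ : μ < 3) :
    P.real {ω | ϵ < ‖hankel L hL fun m => 1 / (N : ℝ) * ∑ i, X (i, m) ω‖} ≤
      (2 * L + 2) *
        Real.exp (-(N * (μ * ϵ - (2 * L + 1) * v * (μ ^ 2 / (2 * (1 - μ / 3)))))) := by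
  refine (measureReal_lt_norm_hankel_le_of_exp hL hN hμ0
    (hX.exists_exp_hankel_le hL hμ0 hμ)).trans (le_of_eq ?_)
  rw [← Real.exp_nat_mul, mul_assoc, ← Real.exp_add]
  congr 2
  push_cast
  ring

/-- Bernstein type tail bound for random Hankel matrices of size two. -/
theorem measureReal_lt_norm_hankel_one_le {N : ℕ} (hL : 1 ≤ 2) (hN : 0 < N)
    {X : Fin N × Fin 3 → Ω → ℝ} {v μ ϵ : ℝ} (hX : IsBoundedCenteredIndep X v P)
    (hμ0 : 0 ≤ μ) (hμ : μ < 3) :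
    P.real {ω | ϵ < ‖hankel 1 hL fun m => 1 / (N : ℝ) * ∑ i, X (i, m) ω‖} ≤
      4 * Real.exp (-(N * (μ * ϵ - 2 * v * (μ ^ 2 / (2 * (1 - μ / 3)))))) := by
  refine (measureReal_lt_norm_hankel_le_of_exp hL hN hμ0
    (hX.exists_exp_hankel_one_le hL hμ0 hμ)).trans (le_of_eq ?_)
  rw [← Real.exp_nat_mul, mul_assoc, ← Real.exp_add]
  congr 2
  push_cast
  ring

/-- Chebyshev type tail bound for random square Hankel matrices. -/
theorem measureReal_lt_norm_hankel_le_div {N L : ℕ} (hL : L ≤ 2 * L) (hN : 0 < N)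
    {X : Fin N × Fin (2 * L + 1) → Ω → ℝ} {v ϵ : ℝ} (hX : IsBoundedCenteredIndep X v P)
    (hϵ : 0 < ϵ) :
    P.real {ω | ϵ < ‖hankel L hL fun m => 1 / (N : ℝ) * ∑ i, X (i, m) ω‖} ≤
      (L + 1) ^ 2 * v / (N * ϵ ^ 2) := by
  have hN' : (0 : ℝ) < N := by exact_mod_cast hN
  have h : ∀ m : Fin (2 * L + 1), Integrable (fun ω => (1 / (N : ℝ) * ∑ i, X (i, m) ω) ^ 2) P ∧
      ∫ ω, (1 / (N : ℝ) * ∑ i, X (i, m) ω) ^ 2 ∂P ≤ v / N := fun m => by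
    have := hX.integral_sum_sq_le (Finset.univ ×ˢ {m})
    rw [Finset.card_product, Finset.card_singleton, Finset.card_univ, Fintype.card_fin,
      mul_one] at this
    simp only [Finset.sum_product, Finset.sum_singleton] at this
    simp only [mul_pow]
    refine ⟨this.1.const_mul _, ?_⟩
    rw [integral_const_mul]
    refine (mul_le_mul_of_nonneg_left this.2 (by positivity)).trans (le_of_eq ?_)
    field_simp
  have hi : ∀ (i : Fin (L + 1)) (j : Fin (2 * L - L + 1)), Integrable (fun ω =>
      (hankel L hL (fun m => 1 / (N : ℝ) * ∑ i, X (i, m) ω) i j) ^ 2) P := fun i j =>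
    (h ⟨(i : ℕ) + (j : ℕ), by omega⟩).1
  have hiB : ∀ (i : Fin (L + 1)) (j : Fin (2 * L - L + 1)), ∫ ω,
      (hankel L hL (fun m => 1 / (N : ℝ) * ∑ i, X (i, m) ω) i j) ^ 2 ∂P ≤ v / N := fun i j =>
    (h ⟨(i : ℕ) + (j : ℕ), by omega⟩).2
  set G : Ω → ℝ := fun ω => ∑ i, ∑ j,
    (hankel L hL (fun m => 1 / (N : ℝ) * ∑ i, X (i, m) ω) i j) ^ 2 with hG
  have hGi : Integrable G P := integrable_finsetSum _ fun i _ => integrable_finsetSum _ fun j _ => hi i j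
  have hGB : ∫ ω, G ω ∂P ≤ (L + 1) ^ 2 * v / N := by
    rw [hG, integral_finsetSum _ fun i _ => integrable_finsetSum _ fun j _ => hi i j]
    simp only [integral_finsetSum _ fun j _ => hi _ j]
    refine (Finset.sum_le_sum fun i _ => Finset.sum_le_sum fun j _ =>
      hiB i j).trans (le_of_eq ?_)
    have : 2 * L - L = L := by omega
    simp only [Finset.sum_const, Finset.card_univ, Fintype.card_fin, nsmul_eq_mul, this]
    push_cast
    ring
  have hmarkov := mul_meas_ge_le_integral_of_nonneg
    (ae_of_all P fun ω => by positivity) hGi (ϵ ^ 2)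
  have hsub : {ω | ϵ < ‖hankel L hL fun m => 1 / (N : ℝ) * ∑ i, X (i, m) ω‖} ⊆
      {ω | ϵ ^ 2 ≤ G ω} := fun ω hω =>
    (pow_le_pow_left₀ hϵ.le (le_of_lt hω) 2).trans (l2_opNorm_sq_le_sum_sq _)
  have h2 := (mul_le_mul_of_nonneg_left (measureReal_mono hsub) (by positivity)).trans
    (hmarkov.trans hGB)
  rw [← div_div, le_div_iff₀ (by positivity), mul_comm]
  exact h2

end IsBoundedCenteredIndep

/-! ### Numerical bounds and choice of parameters. -/

/-- Equality holds at x = c. Taking c = 2 or 8 reduces later estimates to a decimal bound for log 2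
and a quadratic inequality. -/
theorem log_add_one_sub_div_le_log {c x : ℝ} (hc : 0 < c) (hx : 0 < x) :
    Real.log c + 1 - c / x ≤ Real.log x := by
  have h := Real.log_le_sub_one_of_pos (div_pos hc hx)
  rw [Real.log_div hc.ne' hx.ne'] at h
  linarith

theorem log_eight : Real.log 8 = 3 * Real.log 2 := by
  rw [show (8 : ℝ) = 2 ^ 3 by norm_num, Real.log_pow]
  norm_num

theorem le_four_mul_log {x : ℝ} (h2 : 2 ≤ x) (h8 : x ≤ 8) : x ≤ 4 * Real.log x := by
  have hx : 0 < x := by linarith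
  have hl := Real.log_two_gt_d9
  rcases le_total x 4 with h | h
  · have := log_add_one_sub_div_le_log two_pos hx
    have h3 : 2 / x ≤ 0.6931471803 + 1 - x / 4 := by
      rw [div_le_iff₀ hx]
      nlinarith
    linarith
  · have := log_add_one_sub_div_le_log (show (0 : ℝ) < 8 by norm_num) hx
    rw [log_eight] at this
    have h3 : 8 / x ≤ 3 * 0.6931471803 + 1 - x / 4 := by
      rw [div_le_iff₀ hx]
      nlinarith
    linarith

theorem nine_mul_le_log {x : ℝ} (h4 : 4 ≤ x) (h18 : x ≤ 18) : 9 * x ≤ 64 * Real.log x := by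
  have hx : 0 < x := by linarith
  have hl := Real.log_two_gt_d9
  have := log_add_one_sub_div_le_log (show (0 : ℝ) < 8 by norm_num) hx
  rw [log_eight] at this
  have h3 : 8 / x ≤ 3 * 0.6931471803 + 1 - 9 * x / 64 := by
    rw [div_le_iff₀ hx]
    nlinarith
  linarith

/-- A choice of the parameter in the Bernstein bound. -/
theorem exists_bernstein_parameter {M N v ϵ ℓ κ s θ : ℝ} (hM : 0 < M) (hϵ : 0 < ϵ)
    (hN : 4 * max (M * v / ϵ ^ 2) (2 / (3 * ϵ)) * ℓ ≤ N) (hℓ : 0 ≤ ℓ) (hκ : 0 ≤ κ) (hs : 0 ≤ s)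
    (hs2 : s < 2) (hθ : 0 ≤ θ) (hθs : θ ≤ s - κ / M * (s ^ 2 / (2 - s))) :
    ∃ μ, 0 ≤ μ ∧ μ < 3 ∧
      4 * θ * ℓ ≤ N * (μ * ϵ - κ * v * (μ ^ 2 / (2 * (1 - μ / 3)))) := by
  set D := max (M * v / ϵ ^ 2) (2 / (3 * ϵ)) with hD
  have hD0 : 0 < D := lt_of_lt_of_le (by positivity) (le_max_right _ _)
  have h1 : M * v ≤ D * ϵ ^ 2 := (div_le_iff₀ (by positivity)).1 (le_max_left _ _)
  have h2 : 2 ≤ D * (3 * ϵ) := (div_le_iff₀ (by positivity)).1 (le_max_right _ _)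
  have hN0 : 0 ≤ N := le_trans (by positivity) hN
  have hμ : s / (D * ϵ) ≤ 3 * s / 2 := by
    rw [div_le_div_iff₀ (by positivity) two_pos]
    nlinarith
  -- The second entry of the maximum gives Dϵ ≥ 2/3, hence μ ≤ 3s/2 < 3 and 2(1 - μ/3) ≥ 2 - s.
  refine ⟨s / (D * ϵ), by positivity, by linarith, ?_⟩
  have h2s : 0 < 2 - s := by linarith
  have h3 : κ * v * ((s / (D * ϵ)) ^ 2 / (2 * (1 - s / (D * ϵ) / 3))) ≤
      κ / M * (s ^ 2 / (2 - s)) / D := by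
    have hv' : v ≤ D * ϵ ^ 2 / M := by rw [le_div_iff₀ hM]; linarith
    calc κ * v * ((s / (D * ϵ)) ^ 2 / (2 * (1 - s / (D * ϵ) / 3)))
        ≤ κ * (D * ϵ ^ 2 / M) * ((s / (D * ϵ)) ^ 2 / (2 - s)) := by
          refine mul_le_mul (mul_le_mul_of_nonneg_left hv' hκ)
            (div_le_div_of_nonneg_left (by positivity) h2s (by linarith))
            (div_nonneg (by positivity) (by linarith)) (by positivity)
      _ = κ / M * (s ^ 2 / (2 - s)) / D := by field_simp
  have h4 : s / (D * ϵ) * ϵ = s / D := by field_simp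
  rw [h4]
  calc 4 * θ * ℓ = (4 * D * ℓ) * (θ / D) := by field_simp
    _ ≤ N * (θ / D) := mul_le_mul_of_nonneg_right hN (by positivity)
    _ ≤ N * ((s - κ / M * (s ^ 2 / (2 - s))) / D) := by gcongr
    _ ≤ _ := by
      refine mul_le_mul_of_nonneg_left ?_ hN0
      rw [sub_div]
      linarith

/-- The share 1/q of log(M/δ) beyond the first pays for the excess c/M of the prefactor. -/
theorem mul_exp_neg_log_le {c M δ q : ℝ} (hc : 0 < c) (hM : 0 < M) (hδ : 0 < δ) (hq : 0 < q)
    (h : q * Real.log (c / M) ≤ Real.log (M / δ)) {a : ℝ} (ha : (1 + 1 / q) * Real.log (M / δ) ≤ a) :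
    c * Real.exp (-a) ≤ δ := by
  have h1 : Real.log (c / M) ≤ 1 / q * Real.log (M / δ) := by
    rw [one_div, inv_mul_eq_div, le_div_iff₀ hq, mul_comm]
    exact h
  have h2 : Real.exp (-a) ≤ Real.exp (-(Real.log (M / δ) + Real.log (c / M))) :=
    Real.exp_le_exp.2 (by linarith)
  have h3 : Real.exp (-(Real.log (M / δ) + Real.log (c / M))) = δ / c := by
    rw [Real.exp_neg, Real.exp_add, Real.exp_log (by positivity), Real.exp_log (by positivity)]
    field_simp
  rw [h3] at h2
  calc c * Real.exp (-a) ≤ c * (δ / c) := mul_le_mul_of_nonneg_left h2 hc.le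
    _ = δ := by field_simp

/-- This closes the Chebyshev cases: the first entry of the maximum gives Nϵ² ≥ 4Mv log(M/δ). -/
theorem mul_div_le_of_mul_le_log {b M N v ϵ δ : ℝ} (hM : 0 < M) (hv : 0 ≤ v) (hϵ : 0 < ϵ)
    (hδ : 0 < δ) (hN0 : 0 < N) (hℓ : 0 ≤ Real.log (M / δ))
    (hN : 4 * max (M * v / ϵ ^ 2) (2 / (3 * ϵ)) * Real.log (M / δ) ≤ N)
    (hb : b * (M / δ) ≤ 4 * M ^ 2 * Real.log (M / δ)) : b * v / (N * ϵ ^ 2) ≤ δ := by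
  have h1 : 4 * (M * v / ϵ ^ 2) * Real.log (M / δ) ≤ N :=
    le_trans (by gcongr; exact le_max_left _ _) hN
  have h2 : 4 * M * v * Real.log (M / δ) ≤ N * ϵ ^ 2 := by
    rw [← div_le_iff₀ (by positivity)]
    refine le_trans (le_of_eq ?_) h1
    ring
  have h3 : b ≤ 4 * M * Real.log (M / δ) * δ := by
    have : b * M ≤ (4 * M * Real.log (M / δ) * δ) * M := by
      rw [← mul_div_assoc, div_le_iff₀ hδ] at hb
      linarith
    exact le_of_mul_le_mul_right this hM
  rw [div_le_iff₀ (by positivity)]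
  calc b * v ≤ 4 * M * Real.log (M / δ) * δ * v := mul_le_mul_of_nonneg_right h3 hv
    _ = δ * (4 * M * v * Real.log (M / δ)) := by ring
    _ ≤ δ * (N * ϵ ^ 2) := mul_le_mul_of_nonneg_left h2 hδ.le

/-! ### The tail bound at the stated sample size. -/

section Tail
variable {Ω : Type*} [MeasurableSpace Ω] {P : Measure Ω} [IsProbabilityMeasure P]

theorem IsBoundedCenteredIndep.measureReal_lt_norm_hankel_le_of_le {N L : ℕ} (hL : L ≤ 2 * L)
    (hL1 : 1 ≤ L) {X : Fin N × Fin (2 * L + 1) → Ω → ℝ} {v ϵ δ : ℝ}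
    (hX : IsBoundedCenteredIndep X v P) (hv : 0 ≤ v) (hϵ : 0 < ϵ) (hδ : 0 < δ) (hδ1 : δ < 1)
    (hN : 4 * max (((2 * L : ℕ) : ℝ) * v / ϵ ^ 2) (2 / (3 * ϵ)) *
      Real.log (((2 * L : ℕ) : ℝ) / δ) ≤ N) :
    P.real {ω | ϵ < ‖hankel L hL fun m => 1 / (N : ℝ) * ∑ i, X (i, m) ω‖} ≤ δ := by
  have hM2 : (2 : ℝ) ≤ ((2 * L : ℕ) : ℝ) := by exact_mod_cast (by omega : 2 ≤ 2 * L)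
  have hM0 : (0 : ℝ) < ((2 * L : ℕ) : ℝ) := by linarith
  have hMδ : ((2 * L : ℕ) : ℝ) < ((2 * L : ℕ) : ℝ) / δ := by
    rw [lt_div_iff₀ hδ]
    exact mul_lt_of_lt_one_right hM0 hδ1
  have hℓ : 0 < Real.log (((2 * L : ℕ) : ℝ) / δ) := Real.log_pos (by linarith)
  have hN0 : (0 : ℝ) < N := lt_of_lt_of_le (mul_pos (mul_pos four_pos
    (lt_of_lt_of_le (by positivity) (le_max_right _ _))) hℓ) hN
  have hN0' : 0 < N := by exact_mod_cast hN0
  obtain rfl | rfl | hL3 : L = 1 ∨ L = 2 ∨ 3 ≤ L := by omega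
  -- Prefactor 4 = 2M, and s = 2/3 gives 4θ = 4/3, so q = 3; this needs 2³ ≤ M/δ, whence the
  -- threshold 8.
  · rcases le_total (((2 * 1 : ℕ) : ℝ) / δ) 8 with h8 | h8
    · refine (hX.measureReal_lt_norm_hankel_le_div hL hN0' hϵ).trans
        (mul_div_le_of_mul_le_log hM0 hv hϵ hδ hN0 hℓ.le hN ?_)
      have := le_four_mul_log (hM2.trans hMδ.le) h8
      push_cast at this ⊢
      linarith
    · obtain ⟨μ, hμ0, hμ, h⟩ := exists_bernstein_parameter (κ := 2) (s := 2 / 3) (θ := 1 / 3) hM0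
        hϵ hN hℓ.le (by norm_num) (by norm_num) (by norm_num) (by norm_num) (by norm_num)
      refine (hX.measureReal_lt_norm_hankel_one_le hL hN0' hμ0 hμ).trans
        (mul_exp_neg_log_le (q := 3) four_pos hM0 hδ three_pos ?_ (le_trans (le_of_eq ?_) h))
      · rw [show (4 : ℝ) / ((2 * 1 : ℕ) : ℝ) = 2 by norm_num, ← log_eight]
        exact Real.log_le_log (by norm_num) h8
      · ring
  -- Prefactor 6 = (3/2)M, and s = 4/7 gives 4θ = 8/7, so q = 7; the threshold 18 exceeds (3/2)⁷ ≈
  -- 17.1.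
  · rcases le_total (((2 * 2 : ℕ) : ℝ) / δ) 18 with h18 | h18
    · refine (hX.measureReal_lt_norm_hankel_le_div hL hN0' hϵ).trans
        (mul_div_le_of_mul_le_log hM0 hv hϵ hδ hN0 hℓ.le hN ?_)
      have := nine_mul_le_log (le_trans (by norm_num) hMδ.le) h18
      push_cast at this ⊢
      linarith
    · obtain ⟨μ, hμ0, hμ, h⟩ := exists_bernstein_parameter (κ := 5) (s := 4 / 7) (θ := 2 / 7) hM0
        hϵ hN hℓ.le (by norm_num) (by norm_num) (by norm_num) (by norm_num) (by norm_num)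
      have h' := hX.measureReal_lt_norm_hankel_le (ϵ := ϵ) hL hN0' hμ0 hμ
      norm_num only [Nat.cast_ofNat] at h'
      refine h'.trans
        (mul_exp_neg_log_le (q := 7) (by norm_num) hM0 hδ (by norm_num) ?_
          (le_trans (le_of_eq ?_) h))
      · rw [show (6 : ℝ) / ((2 * 2 : ℕ) : ℝ) = 3 / 2 by norm_num,
          show (7 : ℝ) * Real.log (3 / 2) = Real.log ((3 / 2) ^ 7) by rw [Real.log_pow]; norm_num]
        exact Real.log_le_log (by norm_num) (le_trans (by norm_num) h18)
      · ring
  -- Here κ/M ≤ 7/6 and s = 3/5 give 4θ = 6/5, so q = 5; the prefactor is at most (4/3)M, and (4/3)⁵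
  -- < 6 ≤ M/δ.
  · have hM6 : (6 : ℝ) ≤ ((2 * L : ℕ) : ℝ) := by exact_mod_cast (by omega : 6 ≤ 2 * L)
    obtain ⟨μ, hμ0, hμ, h⟩ := exists_bernstein_parameter (κ := 2 * L + 1) (s := 3 / 5)
      (θ := 3 / 10) hM0 hϵ hN hℓ.le (by positivity) (by norm_num) (by norm_num) (by norm_num)
      (by
        have : (2 * (L : ℝ) + 1) / ((2 * L : ℕ) : ℝ) ≤ 7 / 6 := by
          rw [div_le_div_iff₀ hM0 (by norm_num)]
          push_cast at hM6 ⊢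
          linarith
        norm_num only
        linarith)
    refine (hX.measureReal_lt_norm_hankel_le (ϵ := ϵ) hL hN0' hμ0 hμ).trans
      (mul_exp_neg_log_le (q := 5) (by positivity) hM0 hδ (by norm_num) ?_
        (le_trans (le_of_eq ?_) h))
    · have h43 : (2 * (L : ℝ) + 2) / ((2 * L : ℕ) : ℝ) ≤ 4 / 3 := by
        rw [div_le_div_iff₀ hM0 (by norm_num)]
        push_cast at hM6 ⊢
        linarith
      calc 5 * Real.log ((2 * (L : ℝ) + 2) / ((2 * L : ℕ) : ℝ)) ≤ 5 * Real.log (4 / 3) :=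
            mul_le_mul_of_nonneg_left (Real.log_le_log (by positivity) h43) (by norm_num)
        _ = Real.log ((4 / 3) ^ 5) := by rw [Real.log_pow]; norm_num
        _ ≤ _ := Real.log_le_log (by norm_num) (le_trans (by norm_num) (hM6.trans hMδ.le))
    · ring

end Tail

/-! ### Reduction to centred bounded variables. -/

theorem hankel_sub {M L : ℕ} (hL : L ≤ M) (y z : Fin (M + 1) → ℝ) :
    hankel L hL y - hankel L hL z = hankel L hL fun m => y m - z m := rfl

theorem matrixExpectation_hankel {Ω : Type*} [MeasurableSpace Ω] (P : Measure Ω) {M L : ℕ}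
    (hL : L ≤ M) (y : Ω → Fin (M + 1) → ℝ) :
    matrixExpectation P (fun ω => hankel L hL (y ω)) = hankel L hL fun m => ∫ ω, y ω m ∂P := rfl

/-- `‖·‖` on matrices is the spectral norm (operator norm for the Euclidean norms). -/
theorem lemma3
    {Ω₀ Ω : Type*} [MeasurableSpace Ω₀] [MeasurableSpace Ω]
    (P₀ : Measure Ω₀) [IsProbabilityMeasure P₀]
    (P : Measure Ω) [IsProbabilityMeasure P]
    (M L N : ℕ) (hL : 1 ≤ L) (hM : M = 2 * L)
    (ε ϵ δ : ℝ) (hϵ : 0 < ϵ) (hδ : 0 < δ)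
    -- the random variables `Y_m` with values in `[0, 1]` and variance at most `ε ^ 2`
    (Y : Fin (M + 1) → Ω₀ → ℝ)
    (hY_meas : ∀ m, Measurable (Y m))
    (hY_mem : ∀ m ω, Y m ω ∈ Set.Icc (0 : ℝ) 1)
    (hY_var : ∀ m, variance (Y m) P₀ ≤ ε ^ 2)
    -- their independent copies
    (Ycopy : Fin N → Fin (M + 1) → Ω → ℝ)
    (hcopy_meas : ∀ i m, Measurable (Ycopy i m))
    (hcopy_law : ∀ i m, IdentDistrib (Ycopy i m) (Y m) P P₀)
    (hcopy_indep : iIndepFun (fun (p : Fin N × Fin (M + 1)) => Ycopy p.1 p.2) P)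
    -- the number of samples
    (hN : 4 * max ((M : ℝ) * ε ^ 2 / ϵ ^ 2) (2 / (3 * ϵ)) * Real.log ((M : ℝ) / δ) ≤ (N : ℝ)) :
    1 - δ ≤ P.real {ω |
      ‖hankel L (show L ≤ M by omega) (meanEstimator Ycopy ω)
        - matrixExpectation P
            (fun ω' => hankel L (show L ≤ M by omega) (meanEstimator Ycopy ω'))‖ ≤ ϵ} := by
  subst hM
  rcases le_or_gt 1 δ with hδ1 | hδ1
  · exact le_trans (by linarith) measureReal_nonneg
  have hL2 : L ≤ 2 * L := by omega
  have hmem : ∀ i m, ∀ᵐ ω ∂P, Ycopy i m ω ∈ Set.Icc (0 : ℝ) 1 := fun i m =>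
    (hcopy_law i m).symm.ae_snd measurableSet_Icc (ae_of_all _ (hY_mem m))
  set e : Fin N × Fin (2 * L + 1) → ℝ := fun p => ∫ ω, Ycopy p.1 p.2 ω ∂P with he
  -- Equality in law puts the copies in [0, 1] only almost surely; clamping makes the bound hold
  -- everywhere and changes them on a null set only.
  set X : Fin N × Fin (2 * L + 1) → Ω → ℝ := fun p ω =>
    max 0 (min 1 (Ycopy p.1 p.2 ω)) - e p with hXdef
  have hXae : ∀ p, X p =ᵐ[P] fun ω => Ycopy p.1 p.2 ω - e p := fun p => by
    filter_upwards [hmem p.1 p.2] with ω hω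
    simp only [hXdef]
    rw [min_eq_right hω.2, max_eq_right hω.1]
  have hYint : ∀ i m, Integrable (Ycopy i m) P := fun i m =>
    Integrable.of_bound (hcopy_meas i m).aestronglyMeasurable 1 <| by
      filter_upwards [hmem i m] with ω hω
      rw [Real.norm_of_nonneg hω.1]
      exact hω.2
  have he01 : ∀ p, e p ∈ Set.Icc (0 : ℝ) 1 := fun p => by
    refine ⟨integral_nonneg_of_ae ((hmem p.1 p.2).mono fun ω hω => hω.1), ?_⟩
    refine (integral_mono_ae (hYint p.1 p.2) (integrable_const 1)
      ((hmem p.1 p.2).mono fun ω hω => hω.2)).trans ?_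
    simp
  have hmeas : ∀ c : ℝ, Measurable fun y : ℝ => max 0 (min 1 y) - c := fun c =>
    ((measurable_const.max (measurable_const.min measurable_id)).sub_const c)
  have hX : IsBoundedCenteredIndep X (ε ^ 2) P := by
    refine ⟨fun p => (hmeas (e p)).comp (hcopy_meas p.1 p.2), fun p ω => ?_, fun p => ?_,
      fun p => ?_, hcopy_indep.comp (fun p y => max 0 (min 1 y) - e p) fun p => hmeas (e p)⟩
    · have h0 : 0 ≤ max 0 (min 1 (Ycopy p.1 p.2 ω)) := le_max_left _ _
      have h1 : max 0 (min 1 (Ycopy p.1 p.2 ω)) ≤ 1 := max_le zero_le_one (min_le_left _ _)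
      obtain ⟨h2, h3⟩ := he01 p
      exact abs_le.2 ⟨by simp only [hXdef]; linarith, by simp only [hXdef]; linarith⟩
    · rw [integral_congr_ae (hXae p), integral_sub (hYint p.1 p.2) (integrable_const _)]
      simp [he]
    · have h1 : ∫ ω, X p ω ^ 2 ∂P = variance (Ycopy p.1 p.2) P := by
        rw [variance_eq_integral (hcopy_meas p.1 p.2).aemeasurable]
        exact integral_congr_ae ((hXae p).mono fun ω hω => by simp only [hω, he])
      rw [h1, (hcopy_law p.1 p.2).variance_eq]
      exact hY_var p.2
  have htail := hX.measureReal_lt_norm_hankel_le_of_le hL2 hL (sq_nonneg ε) hϵ hδ hδ1 hN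
  set S := {ω | ϵ < ‖hankel L hL2 fun m => 1 / (N : ℝ) * ∑ i, X (i, m) ω‖} with hS
  have hSm : MeasurableSet S := by
    have hc : Continuous fun y : Fin (2 * L + 1) → ℝ => ‖hankel L hL2 y‖ := by
      refine continuous_norm.comp ?_
      exact continuous_matrix fun i j => continuous_apply _
    refine measurableSet_lt measurable_const (hc.measurable.comp (measurable_pi_lambda _ fun m => ?_))
    exact (Finset.measurable_fun_sum _ fun i _ => hX.measurable (i, m)).const_mul _
  have hsub : Sᶜ ≤ᵐ[P] {ω | ‖hankel L hL2 (meanEstimator Ycopy ω)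
      - matrixExpectation P (fun ω' => hankel L hL2 (meanEstimator Ycopy ω'))‖ ≤ ϵ} := by
    filter_upwards [ae_all_iff.2 hXae] with ω hω hωS
    have hωS' : ‖hankel L hL2 fun m => 1 / (N : ℝ) * ∑ i, X (i, m) ω‖ ≤ ϵ := not_lt.1 hωS
    change ‖_‖ ≤ ϵ
    rw [matrixExpectation_hankel, hankel_sub]
    convert hωS' using 3
    funext m
    simp only [meanEstimator]
    rw [integral_const_mul, integral_finsetSum _ fun i _ => hYint i m, ← mul_sub,
      ← Finset.sum_sub_distrib]
    simp only [hω, he]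
  have h1 := measureReal_compl (μ := P) hSm
  rw [probReal_univ] at h1
  have h2 : P.real Sᶜ ≤ _ := ENNReal.toReal_mono (measure_ne_top P _) (measure_mono_ae hsub)
  refine le_trans ?_ h2
  linarith
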